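/- **Setting.** A nondeterministic recursive probabilistic program $W$ is given by its control-flow graph: a finite set $F$ of function names, a finite set $V_{\mathrm r}$ of sampling variables, and for each $f\in F$ a finite set $L_f$ of labels with an initial label $\ell^{f}_{\mathrm{in}}$ and a terminal label $\ell^{f}_{\mathrm{out}}$, and a finite set $V_f$ of integer program variables. Write $\mathrm{Val}_f=\mathbb Z^{V_f}$ and $\mathrm{Val}_{\mathrm r}=\mathbb Z^{V_{\mathrm r}}$. Every label $\ell\ne\ell^f_{\mathrm{out}}$ of $f$ is of exactly one of four kinds: *assignment*, with one outgoing triple $(\ell,u,\ell')$, $u:\mathrm{Val}_f\times\mathrm{Val}_{\mathrm r}\to\mathrm{Val}_f$; *call*, with one outgoing triple $(\ell,(g,v),\ell')$, $g\in F$, $v:\mathrm{Val}_f\to\mathrm{Val}_g$; *branching*, with the two triples $(\ell,\phi,\ell_1),(\ell,\neg\phi,\ell_2)$ for a propositional arithmetic predicate $\phi$ over $V_f$; *nondeterministic*, with the two triples $(\ell,\star,\ell_1),(\ell,\star,\ell_2)$ (then- and else-branch). A stack element is a triple $c=(f,\ell,\nu)$ with $f\in F$, $\ell\in L_f$, $\nu\in\mathrm{Val}_f$;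 it is terminal if $\ell=\ell^f_{\mathrm{out}}$. Let $\mathcal E$ be the set of stack elements. A configuration is a finite word of non-terminal stack elements (call stack, top first). A sampling function $\Upsilon$ assigns to each $r\in V_{\mathrm r}$ a discrete probability distribution on $\mathbb Z$, and $\overline\Upsilon(\mu)=\prod_{r}\Upsilon(r)(\mu(r))$ for $\mu\in\mathrm{Val}_{\mathrm r}$. The semantics is the Markov decision process with states $(w,\mu)$ ($w$ a configuration, $\mu\in\mathrm{Val}_{\mathrm r}$ the last sampling) and actions $\tau,\mathbf{th},\mathbf{el}$. In each step a new sampling $\mu'$ is drawn from $\overline\Upsilon$. The empty configuration stays empty, under any action. From $w=(f,\ell,\nu)\cdot w_0$ the next configuration is obtained from $w_0$ by putting on top: $(f,\ell',u(\nu,\mu'))$ for an assignment; first $(f,\ell',\nu)$ and then $(g,\ell^g_{\mathrm{in}},v(\nu))$ for a call; $(f,\ell_1,\nu)$ if $\nu\models\phi$ and $(f,\ell_2,\nu)$ otherwise for a branching label; $(f,\ell_1,\nu)$ under $\mathbf{th}$ and $(f,\ell_2,\nu)$ under $\mathbf{el}$ for a nondeterministic label; terminal stack elements are dropped instead of being put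 on the stack. At a nondeterministic label only $\mathbf{th},\mathbf{el}$ are enabled, at every other kind of label only $\tau$. A history is a nonempty finite word of states in which consecutive states are joined by a transition of positive probability. A scheduler $\sigma$ assigns to every history a probability distribution over the actions enabled at its last state. For a non-terminal $c$, $\sigma$ induces, by the usual cylinder construction, a probability measure $\mathbb P^\sigma_c$ on infinite runs started in $(c,\mathbf 0)$, with expectation $\mathbb E^\sigma_c$. The termination time $T$ of a run is the least $n\ge0$ at which the configuration is empty ($\infty$ if there is none). Put $\overline T(c)=\sup_\sigma\mathbb E^\sigma_c(T)\in[0,\infty]$ for non-terminal $c$ and $\overline T(c)=0$ for terminal $c$; $W$ is boundedly terminating from $c$ if $\overline T(c)<\infty$. A ranking measure function with corresponding $\epsilon\in(0,\infty)$ is a function $h:\mathcal E\to[0,\infty]$ such that, for all $(f,\ell,\nu)\in\mathcal E$ (with $0\cdot\infty=0$): - (C1) if $\ell=\ell^f_{\mathrm{out}}$, then $h(f,\ell,\nu)=0$; - (C2) if $\ell\ne\ell^f_{\mathrm{out}}$ is an assignment label with triple $(\ell,u,\ell')$, then $\epsilon+\sum_{\mu:\,\overline\Upsilon(\mu)>0}\overline\Upsilon(\mu)\,h(f,\ell',u(\nu,\mu))\le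 h(f,\ell,\nu)$; - (C3) if $\ell\ne\ell^f_{\mathrm{out}}$ is a call label with triple $(\ell,(g,v),\ell')$, then $\epsilon+h(g,\ell^g_{\mathrm{in}},v(\nu))+h(f,\ell',\nu)\le h(f,\ell,\nu)$; - (C4) if $\ell\ne\ell^f_{\mathrm{out}}$ is a branching label with triples $(\ell,\phi,\ell_1),(\ell,\neg\phi,\ell_2)$, then $\mathbf 1_{\nu\models\phi}\,h(f,\ell_1,\nu)+\mathbf 1_{\nu\models\neg\phi}\,h(f,\ell_2,\nu)+\epsilon\le h(f,\ell,\nu)$; - (C5) if $\ell\ne\ell^f_{\mathrm{out}}$ is a nondeterministic label with triples $(\ell,\star,\ell_1),(\ell,\star,\ell_2)$, then $\max\{h(f,\ell_1,\nu),h(f,\ell_2,\nu)\}+\epsilon\le h(f,\ell,\nu)$. **Theorem (Completeness, with soundness).** For every such program $W$ and every sampling function $\Upsilon$: 1. $\overline T$ is a ranking measure function with corresponding $\epsilon=1$. 2. If $h$ is a ranking measure function with corresponding $\epsilon$, then $\overline T(c)\le h(c)/\epsilon$ for every stack element $c$. 3. Consequently ranking measure functions are sound and complete for bounded termination: for every stack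 element $c$, $\overline T(c)<\infty$ if and only if there is a ranking measure function $h$ with $h(c)<\infty$. -/

import Mathlib

open scoped ENNReal NNReal
open MeasureTheory ProbabilityTheory

/-- Valuations over a set of (integer) variables. -/
abbrev Val (V : Type) : Type := V → ℤ

/-- Arithmetic expressions over `V`. No fixed list of arithmetic operations is imposed, and every
expression is assumed to evaluate to an integer under every valuation, so an expression is given by
its evaluation map. -/
abbrev ArithExpr (V : Type) : Type := Val V → ℤ

/-- The comparison symbols `<, ≤, >, ≥`. -/
inductive ArithCmp : Type
  | lt | le | gt | ge

/-- Evaluation of a comparison symbol on integers. -/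
def ArithCmp.holds : ArithCmp → ℤ → ℤ → Prop
  | .lt, a, b => a < b
  | .le, a, b => a ≤ b
  | .gt, a, b => a > b
  | .ge, a, b => a ≥ b

/-- Propositional arithmetic predicates over `V`. -/
inductive ArithPred (V : Type) : Type
  | atom (e₁ : ArithExpr V) (c : ArithCmp) (e₂ : ArithExpr V) : ArithPred V
  | not (φ : ArithPred V) : ArithPred V
  | and (φ ψ : ArithPred V) : ArithPred V
  | or (φ ψ : ArithPred V) : ArithPred V

/-- The satisfaction relation `ν ⊨ φ`. -/
def ArithPred.Sat {V : Type} (ν : Val V) : ArithPred V → Prop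
  | .atom e₁ c e₂ => c.holds (e₁ ν) (e₂ ν)
  | .not φ => ¬ φ.Sat ν
  | .and φ ψ => φ.Sat ν ∧ ψ.Sat ν
  | .or φ ψ => φ.Sat ν ∨ ψ.Sat ν

/-- The outgoing triples of a label `ℓ` of the function `f` in a control-flow graph. The four
constructors are the four kinds of labels:
* `assign u ℓ'`: the only triple is `(ℓ, u, ℓ')`, with update function `u`;
* `call g v ℓ'`: the only triple is `(ℓ, (g, v), ℓ')`, with value-passing function `v`;
* `branch φ ℓ₁ ℓ₂`: the triples are `(ℓ, φ, ℓ₁)` and `(ℓ, ¬φ, ℓ₂)`;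
* `nondet ℓ₁ ℓ₂`: the triples are `(ℓ, ⋆, ℓ₁)` (then-branch) and `(ℓ, ⋆, ℓ₂)` (else-branch). -/
inductive Instr (F Vr : Type) (L PV : F → Type) (f : F) : Type
  | assign (u : Val (PV f) → Val Vr → Val (PV f)) (next : L f) : Instr F Vr L PV f
  | call (g : F) (v : Val (PV f) → Val (PV g)) (next : L f) : Instr F Vr L PV f
  | branch (φ : ArithPred (PV f)) (l₁ l₂ : L f) : Instr F Vr L PV f
  | nondet (l₁ l₂ : L f) : Instr F Vr L PV f

/-- A nondeterministic recursive probabilistic program, given by its control-flow graph: function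
names `F`, sampling variables `Vr`, and for each `f : F` labels `L f`, program variables `PV f`,
the initial label `lin f`, the terminal label `lout f` and the outgoing triples of every
non-terminal label. -/
structure RecProgram where
  F : Type
  Vr : Type
  L : F → Type
  PV : F → Type
  finF : Finite F
  fintypeVr : Fintype Vr
  finL : ∀ f, Finite (L f)
  finPV : ∀ f, Finite (PV f)
  lin : ∀ f, L f
  lout : ∀ f, L f
  instr : ∀ (f : F) (l : L f), l ≠ lout f → Instr F Vr L PV f

attribute [instance] RecProgram.finF RecProgram.fintypeVr RecProgram.finL RecProgram.finPV

namespace RecProgram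

/-- Stack elements `(f, ℓ, ν)`. -/
structure StackElem (W : RecProgram) : Type where
  fn : W.F
  label : W.L fn
  val : Val (W.PV fn)

/-- A stack element is terminal if its label is the terminal label of its function. -/
def StackElem.Terminal {W : RecProgram} (c : W.StackElem) : Prop := c.label = W.lout c.fn

/-- Configurations: finite words of non-terminal stack elements, top of the call stack first. -/
abbrev Config (W : RecProgram) : Type := List {c : W.StackElem // ¬ c.Terminal}

/-- Put a stack element on top of a configuration; a terminal stack element (a function body that
has been completed) is discarded. -/
noncomputable def push (W : RecProgram) (c : W.StackElem) (w : W.Config) : W.Config :=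
  open Classical in if h : c.Terminal then w else ⟨c, h⟩ :: w

/-- Sampling functions: a discrete probability distribution over `ℤ` for each sampling variable. -/
abbrev SamplingFunction (W : RecProgram) : Type := W.Vr → PMF ℤ

/-- The product distribution `Ῡ(μ) = ∏ r, Υ(r)(μ(r))` over valuations of the sampling variables. -/
noncomputable def sampProb (W : RecProgram) (Υ : W.SamplingFunction) (μ : Val W.Vr) : ℝ≥0∞ :=
  ∏ r, Υ r (μ r)

/-- States of the Markov decision process: a configuration, and the sampling of the previous
step. -/
abbrev State (W : RecProgram) : Type := W.Config × Val W.Vr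

/-- The actions of the Markov decision process. -/
inductive Act : Type
  | tau | th | el

/-- The probability transition function `P(s, a, s')` of the Markov decision process. -/
noncomputable def transProb (W : RecProgram) (Υ : W.SamplingFunction)
    (s : W.State) (a : Act) (s' : W.State) : ℝ≥0∞ :=
  open Classical in
  match s.1 with
  | [] => if s'.1 = [] then W.sampProb Υ s'.2 else 0
  | ⟨⟨f, l, ν⟩, hl⟩ :: w =>
    match W.instr f l hl, a with
    | .assign u l', .tau =>
        if s'.1 = W.push ⟨f, l', u ν s'.2⟩ w then W.sampProb Υ s'.2 else 0
    | .call g v l', .tau =>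
        if s'.1 = W.push ⟨g, W.lin g, v ν⟩ (W.push ⟨f, l', ν⟩ w) then W.sampProb Υ s'.2 else 0
    | .branch φ l₁ l₂, .tau =>
        if s'.1 = W.push ⟨f, if φ.Sat ν then l₁ else l₂, ν⟩ w then W.sampProb Υ s'.2 else 0
    | .nondet l₁ _, .th => if s'.1 = W.push ⟨f, l₁, ν⟩ w then W.sampProb Υ s'.2 else 0
    | .nondet _ l₂, .el => if s'.1 = W.push ⟨f, l₂, ν⟩ w then W.sampProb Υ s'.2 else 0
    | _, _ => 0

/-- The set of actions enabled at a state. -/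
def enabled (W : RecProgram) (Υ : W.SamplingFunction) (s : W.State) : Set Act :=
  {a | ∑' s', W.transProb Υ s a s' = 1}

/-- Histories: nonempty finite words of states (in chronological order) in which each state is
reached from the preceding one with positive probability under some action. -/
def History (W : RecProgram) (Υ : W.SamplingFunction) : Type :=
  {ρ : List W.State // ρ ≠ [] ∧ ρ.IsChain fun s s' => ∃ a, 0 < W.transProb Υ s a s'}

/-- The last state of a history. -/
def History.last {W : RecProgram} {Υ : W.SamplingFunction} (ρ : W.History Υ) : W.State :=
  ρ.1.getLast ρ.2.1

/-- Schedulers: to every history a discrete probability distribution over the actions that are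
enabled at its last state. -/
structure Scheduler (W : RecProgram) (Υ : W.SamplingFunction) : Type where
  dist : W.History Υ → PMF Act
  enabled_of_pos : ∀ ρ a, 0 < dist ρ a → a ∈ W.enabled Υ ρ.last

/-- The transition probabilities of the Markov chain over histories that a scheduler induces:
`P*(ρ, ρ·s) = ∑ a ∈ En(last ρ), σ(ρ)(a) · P(last ρ, a, s)`, and `P*(ρ, ρ') = 0` if `ρ'` does not
extend `ρ` by one state. -/
noncomputable def chainProb {W : RecProgram} {Υ : W.SamplingFunction} (σ : W.Scheduler Υ)
    (ρ ρ' : W.History Υ) : ℝ≥0∞ :=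
  open Classical in
  if ρ'.1 = ρ.1 ++ [ρ'.last] then
    ∑' a : W.enabled Υ ρ.last, σ.dist ρ a * W.transProb Υ ρ.last a ρ'.last
  else 0

theorem tsum_chainProb {W : RecProgram} {Υ : W.SamplingFunction} (σ : W.Scheduler Υ)
    (ρ : W.History Υ) : ∑' ρ', chainProb σ ρ ρ' = 1 := by
  classical
  let g : W.State → ℝ≥0∞ := fun s =>
    ∑' a : W.enabled Υ ρ.last, σ.dist ρ a * W.transProb Υ ρ.last a s
  have hg : ∀ s, g s ≠ 0 → ∃ a, 0 < W.transProb Υ ρ.last a s := by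
    intro s hs
    by_contra! hcon
    exact hs (ENNReal.tsum_eq_zero.2 fun a => by simp [nonpos_iff_eq_zero.1 (hcon a)])
  have hval : ∀ s, g s ≠ 0 → ρ.1 ++ [s] ≠ [] ∧
      (ρ.1 ++ [s]).IsChain fun s s' => ∃ a, 0 < W.transProb Υ s a s' := by
    intro s hs
    refine ⟨by simp, List.isChain_append.2 ⟨ρ.2.2, List.isChain_singleton _, ?_⟩⟩
    intro x hx y hy
    have hx' : ρ.last = x := by
      rw [List.getLast?_eq_getLast_of_ne_nil ρ.2.1] at hx
      simpa [History.last] using hx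
    have hy' : s = y := by simpa using hy
    subst hx' hy'
    exact hg _ hs
  have hsum : ∑' ρ', chainProb σ ρ ρ' = ∑' s, g s := by
    refine tsum_eq_tsum_of_ne_zero_bij
      (fun s : Function.support g => (⟨ρ.1 ++ [s.1], hval s.1 s.2⟩ : W.History Υ)) ?_ ?_ ?_
    · intro s t hst
      have := congrArg Subtype.val hst
      exact Subtype.ext (by simpa using this)
    · intro ρ' hρ'
      have h1 : ρ'.1 = ρ.1 ++ [ρ'.last] := by
        by_contra hne
        exact hρ' (by simp [chainProb, hne])
      refine ⟨⟨ρ'.last, ?_⟩, Subtype.ext h1.symm⟩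
      have h2 := hρ'
      rw [Function.mem_support, chainProb, if_pos h1] at h2
      exact h2
    · intro s
      have hl : History.last (⟨ρ.1 ++ [s.1], hval s.1 s.2⟩ : W.History Υ) = s.1 := by
        simp [History.last]
      simp [chainProb, hl, g]
  rw [hsum, ENNReal.tsum_comm]
  have : ∀ a : W.enabled Υ ρ.last,
      ∑' s, σ.dist ρ a * W.transProb Υ ρ.last a s = σ.dist ρ a := by
    intro a
    rw [ENNReal.tsum_mul_left]
    have ha : ∑' s, W.transProb Υ ρ.last a s = 1 := a.2
    rw [ha, mul_one]
  rw [tsum_congr this, ← (σ.dist ρ).tsum_coe]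
  refine tsum_subtype_eq_of_support_subset fun a ha => ?_
  exact σ.enabled_of_pos ρ a (pos_iff_ne_zero.2 ha)

/-- One step of the Markov chain over histories, as a probability distribution. -/
noncomputable def chainStep {W : RecProgram} {Υ : W.SamplingFunction} (σ : W.Scheduler Υ)
    (ρ : W.History Υ) : PMF (W.History Υ) :=
  ⟨chainProb σ ρ, tsum_chainProb σ ρ ▸ ENNReal.summable.hasSum⟩

/-- Every set of histories is measurable. -/
instance instMeasurableSpaceHistory (W : RecProgram) (Υ : W.SamplingFunction) :
    MeasurableSpace (W.History Υ) := ⊤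

/-- The transition kernel of the Markov chain over histories from time `n` to time `n + 1`; it
depends only on the history reached at time `n`. -/
noncomputable def chainKernel {W : RecProgram} {Υ : W.SamplingFunction} (σ : W.Scheduler Υ)
    (n : ℕ) : Kernel (Finset.Iic n → W.History Υ) (W.History Υ) where
  toFun ω := (chainStep σ (ω ⟨n, Finset.mem_Iic.2 le_rfl⟩)).toMeasure
  measurable' := (measurable_from_top
    (f := fun ρ : W.History Υ => (chainStep σ ρ).toMeasure)).comp (measurable_pi_apply _)

instance isMarkovKernel_chainKernel {W : RecProgram} {Υ : W.SamplingFunction}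
    (σ : W.Scheduler Υ) (n : ℕ) : IsMarkovKernel (chainKernel σ n) :=
  ⟨fun ω => PMF.toMeasure.isProbabilityMeasure
    (chainStep σ (ω ⟨n, Finset.mem_Iic.2 le_rfl⟩))⟩

/-- The initial history `(c, 0)`, where the non-terminal stack element `c` is viewed as a one-letter
configuration and `0` is the zero valuation of the sampling variables. -/
def initHistory (W : RecProgram) (Υ : W.SamplingFunction) (c : W.StackElem)
    (hc : ¬ c.Terminal) : W.History Υ :=
  ⟨[([⟨c, hc⟩], 0)], by simp, List.isChain_singleton _⟩

/-- The probability measure on infinite sequences of histories (runs) under the scheduler `σ` with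
initial non-terminal stack element `c`: the law of the Markov chain over histories started at
`(c, 0)`. It gives the cylinder of `ρ₀ … ρₙ` the mass `∏ k < n, P*(ρₖ, ρₖ₊₁)` if `ρ₀ = (c, 0)`, and
`0` otherwise. -/
noncomputable def runMeasure {W : RecProgram} {Υ : W.SamplingFunction} (σ : W.Scheduler Υ)
    (c : W.StackElem) (hc : ¬ c.Terminal) : Measure (ℕ → W.History Υ) :=
  Kernel.traj (X := fun _ => W.History Υ) (chainKernel σ) 0 fun _ => W.initHistory Υ c hc

/-- The termination time of a run: the least `n` such that the configuration reached at time `n` is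
empty, and `∞` if there is none. -/
noncomputable def termTime {W : RecProgram} {Υ : W.SamplingFunction}
    (ω : ℕ → W.History Υ) : ℝ≥0∞ :=
  ⨅ (n : ℕ) (_ : (ω n).last.1 = []), (n : ℝ≥0∞)

/-- `T̄(c)`: the supremum over all schedulers of the expected termination time from `c` if `c` is
non-terminal, and `0` if `c` is terminal. -/
noncomputable def supTime (W : RecProgram) (Υ : W.SamplingFunction) (c : W.StackElem) : ℝ≥0∞ :=
  open Classical in
  if hc : c.Terminal then 0
  else ⨆ σ : W.Scheduler Υ, ∫⁻ ω, termTime ω ∂(runMeasure σ c hc)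

/-- `W` is boundedly terminating from `c`. -/
def BoundedlyTerminating (W : RecProgram) (Υ : W.SamplingFunction) (c : W.StackElem) : Prop :=
  W.supTime Υ c < ∞

/-- The support of the distribution `Ῡ`. -/
def sampSupport (W : RecProgram) (Υ : W.SamplingFunction) : Set (Val W.Vr) :=
  {μ | 0 < W.sampProb Υ μ}

/-- The condition that a ranking measure function `h` with decrease `ε` has to satisfy at a
non-terminal label `l` of `f` with the given outgoing triples, under the valuation `ν`. -/
def StepCondition (W : RecProgram) (Υ : W.SamplingFunction) (ε : ℝ≥0)
    (h : W.StackElem → ℝ≥0∞) (f : W.F) (l : W.L f) (ν : Val (W.PV f)) :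
    Instr W.F W.Vr W.L W.PV f → Prop
  | .assign u l' =>
      ε + ∑' μ : W.sampSupport Υ, W.sampProb Υ μ * h ⟨f, l', u ν μ⟩ ≤ h ⟨f, l, ν⟩
  | .call g v l' => ε + h ⟨g, W.lin g, v ν⟩ + h ⟨f, l', ν⟩ ≤ h ⟨f, l, ν⟩
  | .branch φ l₁ l₂ =>
      {x | φ.Sat x}.indicator (fun x => h ⟨f, l₁, x⟩) ν +
        {x | φ.not.Sat x}.indicator (fun x => h ⟨f, l₂, x⟩) ν + ε ≤ h ⟨f, l, ν⟩
  | .nondet l₁ l₂ => max (h ⟨f, l₁, ν⟩) (h ⟨f, l₂, ν⟩) + ε ≤ h ⟨f, l, ν⟩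

/-- `h` is a ranking measure function with corresponding `ε ∈ (0, ∞)`. -/
def IsRankingWith (W : RecProgram) (Υ : W.SamplingFunction) (ε : ℝ≥0)
    (h : W.StackElem → ℝ≥0∞) : Prop :=
  0 < ε ∧
    (∀ (f : W.F) (ν : Val (W.PV f)), h ⟨f, W.lout f, ν⟩ = 0) ∧
    ∀ (f : W.F) (l : W.L f) (hl : l ≠ W.lout f) (ν : Val (W.PV f)),
      W.StepCondition Υ ε h f l ν (W.instr f l hl)

/-- `h` is a ranking measure function. -/
def IsRankingMeasureFunction (W : RecProgram) (Υ : W.SamplingFunction)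
    (h : W.StackElem → ℝ≥0∞) : Prop :=
  ∃ ε : ℝ≥0, W.IsRankingWith Υ ε h

end RecProgram

/-! The proof is dynamic programming. `horizonTime n w` is value iteration for the number of steps
spent before termination within `n` steps, and `optimalTime` is its supremum over `n`.

Completeness: monotone convergence turns the recursion into the Bellman inequality
`one_add_stepMean_optimalTime_le`, which yields every ranking condition except the one for calls. A
call leaves two elements on the stack, and there superadditivity under concatenation of stacks
(`optimalTime_add_le`) is needed. It is proved at finite horizon by induction, so no schedulers have
to be glued together.

Soundness: for a ranking function `h`, the sum of `h` over the stack drops by at least `ε` in mean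
at each step (`IsRankingWith.add_stepMean_le`), so it dominates `ε` times every finite-horizon
value.

Schedulers and run measures enter only through `supTime_eq_optimalTime`: no scheduler beats value
iteration, and for each horizon a deterministic scheduler attains it. -/

namespace RecProgram

/-! ### One-step expectations in the decision process. -/

/-- The configurations that follow a configuration under an action, as a function of the new
sampling; `none` if the action is not enabled. -/
noncomputable def next (W : RecProgram) : W.Config → Act → Option (Val W.Vr → W.Config)
  | [], _ => some fun _ => []
  | ⟨⟨f, l, ν⟩, hl⟩ :: w, a =>
    open Classical in
    match W.instr f l hl, a with
    | .assign u l', .tau => some fun μ => W.push ⟨f, l', u ν μ⟩ w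
    | .call g v l', .tau => some fun _ => W.push ⟨g, W.lin g, v ν⟩ (W.push ⟨f, l', ν⟩ w)
    | .branch φ l₁ l₂, .tau => some fun _ => W.push ⟨f, if φ.Sat ν then l₁ else l₂, ν⟩ w
    | .nondet l₁ _, .th => some fun _ => W.push ⟨f, l₁, ν⟩ w
    | .nondet _ l₂, .el => some fun _ => W.push ⟨f, l₂, ν⟩ w
    | _, _ => none

/-- The expectation of `φ` after one step from `w` under the action `a`; it is `0` if `a` is not
enabled. -/
noncomputable def stepMean (W : RecProgram) (Υ : W.SamplingFunction) (φ : W.Config → ℝ≥0∞)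
    (w : W.Config) (a : Act) : ℝ≥0∞ :=
  (W.next w a).elim 0 fun g => ∑' μ, W.sampProb Υ μ * φ (g μ)

/-- The optimal expected number of steps before termination, among the first `n` steps. -/
noncomputable def horizonTime (W : RecProgram) (Υ : W.SamplingFunction) :
    ℕ → W.Config → ℝ≥0∞
  | 0, _ => 0
  | _ + 1, [] => 0
  | n + 1, c :: w => 1 + ⨆ a, W.stepMean Υ (W.horizonTime Υ n) (c :: w) a

variable {W : RecProgram} {Υ : W.SamplingFunction}

/-- These are the point masses of a product of probability measures on a countable space. -/
theorem tsum_sampProb : ∑' μ, W.sampProb Υ μ = 1 := by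
  have h := measure_univ (μ := Measure.pi fun r => (Υ r).toMeasure)
  rw [← Set.iUnion_of_singleton, measure_iUnion] at h
  · rw [← h]
    refine tsum_congr fun μ => ?_
    rw [Measure.pi_singleton]
    exact Finset.prod_congr rfl fun r _ =>
      (PMF.toMeasure_apply_singleton _ _ (measurableSet_singleton _)).symm
  · exact fun i j hij => Set.disjoint_singleton.2 hij
  · exact fun i => measurableSet_singleton i

theorem tsum_sampProb_mul_const (x : ℝ≥0∞) : ∑' μ, W.sampProb Υ μ * x = x := by
  rw [ENNReal.tsum_mul_right, tsum_sampProb, one_mul]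

theorem transProb_eq_next (s : W.State) (a : Act) (s' : W.State) :
    W.transProb Υ s a s' = open Classical in
      (W.next s.1 a).elim 0 fun g => if s'.1 = g s'.2 then W.sampProb Υ s'.2 else 0 := by
  obtain ⟨w, μ⟩ := s
  rcases w with _ | ⟨⟨⟨f, l, ν⟩, hl⟩, w⟩
  · rfl
  · dsimp only [transProb, next]
    cases W.instr f l hl <;> cases a <;> rfl

theorem tsum_transProb_mul (φ : W.Config → ℝ≥0∞) (s : W.State) (a : Act) :
    ∑' s', W.transProb Υ s a s' * φ s'.1 = W.stepMean Υ φ s.1 a := by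
  classical
  simp_rw [transProb_eq_next, stepMean]
  cases W.next s.1 a with
  | none => simp
  | some g =>
    rw [ENNReal.tsum_prod', ENNReal.tsum_comm]
    refine tsum_congr fun μ => ?_
    rw [tsum_eq_single (g μ)]
    · simp
    · intro w hw
      simp [hw]

theorem mem_enabled_iff (s : W.State) (a : Act) :
    a ∈ W.enabled Υ s ↔ (W.next s.1 a).isSome := by
  have h := tsum_transProb_mul (Υ := Υ) (fun _ => 1) s a
  simp only [mul_one] at h
  rw [enabled, Set.mem_ofPred_eq, h, stepMean]
  cases W.next s.1 a <;> simp [tsum_sampProb]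

theorem exists_next (w : W.Config) : ∃ a, (W.next w a).isSome := by
  rcases w with _ | ⟨⟨⟨f, l, ν⟩, hl⟩, w⟩
  · exact ⟨.tau, rfl⟩
  · cases hi : W.instr f l hl
    case nondet => exact ⟨.th, by simp [next, hi]⟩
    all_goals exact ⟨.tau, by simp [next, hi]⟩

instance : Finite Act :=
  Finite.of_surjective (fun i : Fin 3 => match i with | 0 => Act.tau | 1 => .th | 2 => .el)
    fun a => by cases a; exacts [⟨0, rfl⟩, ⟨1, rfl⟩, ⟨2, rfl⟩]

/-- There are finitely many actions, at least one is enabled, and disabled ones contribute only `0`.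
Having an enabled maximizer matters because `stepMean_add_const` fails for disabled actions. -/
theorem exists_optimal_action (φ : W.Config → ℝ≥0∞) (w : W.Config) :
    ∃ a, (W.next w a).isSome ∧ ⨆ b, W.stepMean Υ φ w b ≤ W.stepMean Υ φ w a := by
  obtain ⟨a, ha, hmax⟩ := Set.exists_max_image {a | (W.next w a).isSome} (W.stepMean Υ φ w)
    (Set.toFinite _) (exists_next w)
  refine ⟨a, ha, iSup_le fun b => ?_⟩
  by_cases hb : (W.next w b).isSome
  · exact hmax b hb
  · simp [stepMean, Option.not_isSome_iff_eq_none.1 hb]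

theorem stepMean_mono {φ ψ : W.Config → ℝ≥0∞} (h : ∀ w, φ w ≤ ψ w) (w : W.Config) (a : Act) :
    W.stepMean Υ φ w a ≤ W.stepMean Υ ψ w a := by
  unfold stepMean
  cases W.next w a with
  | none => simp
  | some g => exact ENNReal.tsum_le_tsum fun μ => by gcongr; exact h _

theorem stepMean_const_add_le (x : ℝ≥0∞) (φ : W.Config → ℝ≥0∞) (w : W.Config) (a : Act) :
    W.stepMean Υ (fun w => x + φ w) w a ≤ x + W.stepMean Υ φ w a := by
  unfold stepMean
  cases W.next w a with
  | none => simp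
  | some g => simp [mul_add, ENNReal.tsum_add, tsum_sampProb_mul_const]

theorem stepMean_add_const {w : W.Config} {a : Act} (ha : (W.next w a).isSome) (x : ℝ≥0∞)
    (φ : W.Config → ℝ≥0∞) :
    W.stepMean Υ (fun w => φ w + x) w a = W.stepMean Υ φ w a + x := by
  obtain ⟨g, hg⟩ := Option.isSome_iff_exists.1 ha
  simp [stepMean, hg, mul_add, ENNReal.tsum_add, tsum_sampProb_mul_const]

theorem push_append (c : W.StackElem) (w w' : W.Config) :
    W.push c (w ++ w') = W.push c w ++ w' := by
  unfold push
  split <;> simp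

/-- A step inspects only the top element. The upper part must be nonempty, since otherwise the step
would act on `w'`. -/
theorem next_append (c : {c : W.StackElem // ¬ c.Terminal}) (w w' : W.Config) (a : Act) :
    W.next (c :: w ++ w') a = (W.next (c :: w) a).map fun g μ => g μ ++ w' := by
  obtain ⟨⟨f, l, ν⟩, hl⟩ := c
  dsimp only [next, List.cons_append]
  cases W.instr f l hl <;> cases a <;> simp [push_append]

theorem stepMean_append (φ : W.Config → ℝ≥0∞) (c : {c : W.StackElem // ¬ c.Terminal})
    (w w' : W.Config) (a : Act) :
    W.stepMean Υ φ (c :: w ++ w') a = W.stepMean Υ (fun v => φ (v ++ w')) (c :: w) a := by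
  rw [stepMean, next_append, stepMean]
  cases W.next (c :: w) a <;> rfl

/-! ### Finite-horizon values: monotonicity and superadditivity. -/

@[simp]
theorem horizonTime_nil (n : ℕ) : W.horizonTime Υ n [] = 0 := by
  cases n <;> rfl

theorem horizonTime_succ_le (n : ℕ) (w : W.Config) :
    W.horizonTime Υ (n + 1) w ≤ 1 + W.horizonTime Υ n w := by
  induction n generalizing w with
  | zero =>
    cases w with
    | nil => simp
    | cons c w =>
      simp only [horizonTime, stepMean]
      gcongr
      refine iSup_le fun a => ?_
      cases W.next (c :: w) a <;> simp
  | succ n ih =>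
    cases w with
    | nil => simp
    | cons c w =>
      rw [horizonTime, horizonTime]
      gcongr
      refine iSup_le fun a => ((stepMean_mono ih _ a).trans (stepMean_const_add_le _ _ _ a)).trans ?_
      gcongr
      exact le_iSup (fun a => W.stepMean Υ (W.horizonTime Υ n) (c :: w) a) a

theorem monotone_horizonTime (w : W.Config) : Monotone fun n => W.horizonTime Υ n w := by
  refine monotone_nat_of_le_succ fun n => ?_
  induction n generalizing w with
  | zero => exact zero_le
  | succ n ih =>
    cases w with
    | nil => simp
    | cons c w =>
      rw [horizonTime, horizonTime]
      gcongr
      exact stepMean_mono ih _ _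

/-- The induction step shared by the next two lemmas: play an action optimal for `φ` on the upper
stack while `w'` lies untouched below; the constant `x` passes through the expectation. -/
theorem add_le_of_optimal {n : ℕ} {w : W.Config} {w' : W.Config} {x : ℝ≥0∞}
    {φ : W.Config → ℝ≥0∞} {c : {c : W.StackElem // ¬ c.Terminal}}
    (h : ∀ v, φ v + x ≤ W.horizonTime Υ n (v ++ w')) :
    (1 + ⨆ a, W.stepMean Υ φ (c :: w) a) + x ≤ W.horizonTime Υ (n + 1) (c :: w ++ w') := by
  obtain ⟨a, ha, hmax⟩ := exists_optimal_action (Υ := Υ) φ (c :: w)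
  rw [List.cons_append, horizonTime, add_assoc]
  gcongr
  calc (⨆ a, W.stepMean Υ φ (c :: w) a) + x
      ≤ W.stepMean Υ φ (c :: w) a + x := by gcongr
    _ = W.stepMean Υ (fun v => φ v + x) (c :: w) a := (stepMean_add_const ha _ _).symm
    _ ≤ W.stepMean Υ (fun v => W.horizonTime Υ n (v ++ w')) (c :: w) a := stepMean_mono h _ _
    _ = W.stepMean Υ (W.horizonTime Υ n) (c :: w ++ w') a := (stepMean_append _ _ _ _ _).symm
    _ ≤ _ := le_iSup (fun a => W.stepMean Υ (W.horizonTime Υ n) (c :: w ++ w') a) a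

/-- A step spent on the upper stack counts one, and taking one step away from `w'` costs at most one
by `horizonTime_succ_le`. -/
theorem horizonTime_le_append (m : ℕ) (w w' : W.Config) :
    W.horizonTime Υ m w' ≤ W.horizonTime Υ m (w ++ w') := by
  induction m generalizing w with
  | zero => exact zero_le
  | succ m ih =>
    cases w with
    | nil => simp
    | cons c w =>
      refine (horizonTime_succ_le m w').trans ?_
      refine le_trans ?_ (add_le_of_optimal (φ := fun _ => 0) (x := W.horizonTime Υ m w')
        fun v => by rw [zero_add]; exact ih v)
      gcongr
      exact le_self_add

theorem horizonTime_add_le (n m : ℕ) (w w' : W.Config) :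
    W.horizonTime Υ n w + W.horizonTime Υ m w' ≤ W.horizonTime Υ (n + m) (w ++ w') := by
  induction n generalizing w with
  | zero => simpa [horizonTime] using horizonTime_le_append m w w'
  | succ n ih =>
    cases w with
    | nil => simpa using monotone_horizonTime w' (by lia)
    | cons c w =>
      rw [show n + 1 + m = n + m + 1 by lia]
      exact add_le_of_optimal ih

/-! ### Completeness: the optimal time is a ranking function. -/

/-- The optimal expected number of steps before termination. -/
noncomputable def optimalTime (W : RecProgram) (Υ : W.SamplingFunction) (w : W.Config) : ℝ≥0∞ :=
  ⨆ n, W.horizonTime Υ n w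

theorem optimalTime_add_le (w w' : W.Config) :
    W.optimalTime Υ w + W.optimalTime Υ w' ≤ W.optimalTime Υ (w ++ w') := by
  rw [optimalTime, optimalTime, ENNReal.iSup_add_iSup_of_monotone (monotone_horizonTime w)
    (monotone_horizonTime w')]
  exact iSup_le fun n => (horizonTime_add_le n n w w').trans
    (le_iSup (fun n => W.horizonTime Υ n (w ++ w')) _)

theorem stepMean_optimalTime (w : W.Config) (a : Act) :
    W.stepMean Υ (W.optimalTime Υ) w a = ⨆ n, W.stepMean Υ (W.horizonTime Υ n) w a := by
  unfold stepMean
  cases W.next w a with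
  | none => simp
  | some g =>
    simp only [Option.elim_some, optimalTime, ENNReal.mul_iSup, ← lintegral_count]
    exact lintegral_iSup (fun _ => measurable_of_countable _) fun n m h μ => by
      dsimp only
      gcongr
      exact monotone_horizonTime _ h

theorem one_add_stepMean_optimalTime_le (c : {c : W.StackElem // ¬ c.Terminal}) (w : W.Config)
    (a : Act) :
    1 + W.stepMean Υ (W.optimalTime Υ) (c :: w) a ≤ W.optimalTime Υ (c :: w) := by
  rw [stepMean_optimalTime, ENNReal.add_iSup]
  refine iSup_le fun n => le_trans ?_ (le_iSup (fun n => W.horizonTime Υ n (c :: w)) (n + 1))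
  rw [horizonTime]
  gcongr
  exact le_iSup (fun a => W.stepMean Υ (W.horizonTime Υ n) (c :: w) a) a

theorem isRankingWith_optimalTime :
    W.IsRankingWith Υ 1 fun c => W.optimalTime Υ (W.push c []) := by
  refine ⟨one_pos, fun f ν => ?_, ?_⟩
  · have h : (⟨f, W.lout f, ν⟩ : W.StackElem).Terminal := rfl
    simp [push, h, optimalTime]
  intro f l hl ν
  have hp : W.push ⟨f, l, ν⟩ [] = [⟨⟨f, l, ν⟩, hl⟩] := dif_neg hl
  have key := one_add_stepMean_optimalTime_le (Υ := Υ) ⟨⟨f, l, ν⟩, hl⟩ []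
  rw [← hp] at key
  simp only [stepMean, hp, next] at key
  cases hi : W.instr f l hl with
  | assign u l' =>
    specialize key .tau
    simp only [hi, Option.elim_some] at key
    simp only [StepCondition, ENNReal.coe_one]
    refine le_trans ?_ (key.trans_eq (by rw [hp]))
    gcongr
    exact ENNReal.tsum_comp_le_tsum_of_injective Subtype.val_injective
      (fun μ => W.sampProb Υ μ * W.optimalTime Υ (W.push ⟨f, l', u ν μ⟩ []))
  | call g v l' =>
    specialize key .tau
    simp only [hi, Option.elim_some, tsum_sampProb_mul_const] at key
    simp only [StepCondition, ENNReal.coe_one]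
    refine le_trans ?_ (key.trans_eq (by rw [hp]))
    rw [add_assoc]
    gcongr
    -- After the call the stack is the callee above the return point, so superadditivity splits its
    -- value.
    refine (optimalTime_add_le _ _).trans_eq ?_
    rw [← push_append, List.nil_append]
  | branch φ l₁ l₂ =>
    specialize key .tau
    simp only [hi, Option.elim_some, tsum_sampProb_mul_const] at key
    simp only [StepCondition, ENNReal.coe_one]
    refine le_trans (le_of_eq ?_) (key.trans_eq (by rw [hp]))
    by_cases h : φ.Sat ν <;> simp [h, ArithPred.Sat, add_comm]
  | nondet l₁ l₂ =>
    have h1 := key .th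
    have h2 := key .el
    simp only [hi, Option.elim_some, tsum_sampProb_mul_const] at h1 h2
    simp only [StepCondition, ENNReal.coe_one]
    rw [add_comm, add_max, hp]
    exact max_le h1 h2

/-! ### Soundness: the stack sum of a ranking function. -/

/-- The sum of `h` over the elements of the stack. -/
noncomputable def stackSum (h : W.StackElem → ℝ≥0∞) (w : W.Config) : ℝ≥0∞ :=
  (w.map fun c => h c).sum

theorem IsRankingWith.stackSum_push {ε : ℝ≥0} {h : W.StackElem → ℝ≥0∞}
    (hh : W.IsRankingWith Υ ε h) (c : W.StackElem) (w : W.Config) :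
    stackSum h (W.push c w) = h c + stackSum h w := by
  unfold push
  split
  · next hc =>
    obtain ⟨f, l, ν⟩ := c
    obtain rfl : l = W.lout f := hc
    rw [hh.2.1, zero_add]
  · simp [stackSum]

/-- The elements below the top add a constant, which the expectation preserves, so the ranking
condition for the top element suffices. -/
theorem IsRankingWith.add_stepMean_le {ε : ℝ≥0} {h : W.StackElem → ℝ≥0∞}
    (hh : W.IsRankingWith Υ ε h) (c : {c : W.StackElem // ¬ c.Terminal}) (w : W.Config)
    {a : Act} (ha : (W.next (c :: w) a).isSome) :
    ε + W.stepMean Υ (stackSum h) (c :: w) a ≤ stackSum h (c :: w) := by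
  obtain ⟨⟨f, l, ν⟩, hl⟩ := c
  have hc := hh.2.2 f l hl ν
  rw [show stackSum h (⟨⟨f, l, ν⟩, hl⟩ :: w) = h ⟨f, l, ν⟩ + stackSum h w by simp [stackSum]]
  revert ha
  dsimp only [stepMean, next]
  cases hi : W.instr f l hl with
  | assign u l' =>
    rw [hi] at hc
    -- Only `tau` survives: the other actions are not enabled, which contradicts `ha`.
    cases a <;> simp [hh.stackSum_push, mul_add, ENNReal.tsum_add, tsum_sampProb_mul_const]
    rw [← add_assoc]
    gcongr
    refine le_trans (le_of_eq ?_) hc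
    congr 1
    refine (tsum_subtype_eq_of_support_subset
      (f := fun μ => W.sampProb Υ μ * h ⟨f, l', u ν μ⟩) fun μ hμ => ?_).symm
    exact pos_iff_ne_zero.2 (left_ne_zero_of_mul hμ)
  | call g v l' =>
    rw [hi] at hc
    cases a <;> simp [hh.stackSum_push, tsum_sampProb_mul_const]
    rw [← add_assoc, ← add_assoc]
    gcongr
    exact hc
  | branch φ l₁ l₂ =>
    rw [hi] at hc
    cases a <;> simp [hh.stackSum_push, tsum_sampProb_mul_const]
    rw [← add_assoc]
    gcongr
    refine le_trans (le_of_eq ?_) hc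
    by_cases h : φ.Sat ν <;> simp [h, ArithPred.Sat, add_comm]
  | nondet l₁ l₂ =>
    rw [hi] at hc
    simp only [StepCondition] at hc
    rw [add_comm, add_max, max_le_iff] at hc
    cases a <;> simp [hh.stackSum_push, tsum_sampProb_mul_const]
    · rw [← add_assoc]
      gcongr
      exact hc.1
    · rw [← add_assoc]
      gcongr
      exact hc.2

theorem mul_stepMean (x : ℝ≥0∞) (φ : W.Config → ℝ≥0∞) (w : W.Config) (a : Act) :
    x * W.stepMean Υ φ w a = W.stepMean Υ (fun w => x * φ w) w a := by
  unfold stepMean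
  cases W.next w a with
  | none => simp
  | some g =>
    simp only [Option.elim_some, ← ENNReal.tsum_mul_left]
    exact tsum_congr fun μ => mul_left_comm _ _ _

theorem IsRankingWith.mul_horizonTime_le {ε : ℝ≥0} {h : W.StackElem → ℝ≥0∞}
    (hh : W.IsRankingWith Υ ε h) (n : ℕ) (w : W.Config) :
    ε * W.horizonTime Υ n w ≤ stackSum h w := by
  induction n generalizing w with
  | zero => simp [horizonTime]
  | succ n ih =>
    cases w with
    | nil => simp
    | cons c w =>
      obtain ⟨a, ha, hmax⟩ := exists_optimal_action (Υ := Υ) (W.horizonTime Υ n) (c :: w)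
      rw [horizonTime, mul_add, mul_one]
      refine le_trans ?_ (hh.add_stepMean_le c w ha)
      gcongr
      calc _ ≤ ε * W.stepMean Υ (W.horizonTime Υ n) (c :: w) a := by gcongr
        _ = _ := mul_stepMean _ _ _ _
        _ ≤ _ := stepMean_mono ih _ _

theorem IsRankingWith.optimalTime_push_le {ε : ℝ≥0} {h : W.StackElem → ℝ≥0∞}
    (hh : W.IsRankingWith Υ ε h) (c : W.StackElem) :
    W.optimalTime Υ (W.push c []) ≤ h c / ε := by
  refine iSup_le fun n => ?_
  rw [ENNReal.le_div_iff_mul_le (.inl (by simpa using hh.1.ne')) (.inl ENNReal.coe_ne_top),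
    mul_comm]
  refine (hh.mul_horizonTime_le n _).trans_eq ?_
  rw [hh.stackSum_push]
  simp [stackSum]

end RecProgram

/-! ### Run measures: conditioning on the past, and termination time as a sum. -/

/-- Cut the trajectory at time `k`: given the past `x`, the next coordinate has law `κ k x`. -/
theorem ProbabilityTheory.Kernel.lintegral_traj_succ {X : ℕ → Type*}
    [∀ n, MeasurableSpace (X n)]
    (κ : (n : ℕ) → Kernel (Π i : Finset.Iic n, X i) (X (n + 1))) [∀ n, IsMarkovKernel (κ n)]
    (x₀ : Π i : Finset.Iic 0, X i) (k : ℕ)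
    {F : (Π i : Finset.Iic k, X i) × X (k + 1) → ℝ≥0∞} (hF : Measurable F) :
    ∫⁻ ω, F (Preorder.frestrictLe k ω, ω (k + 1)) ∂(Kernel.traj κ 0 x₀) =
      ∫⁻ ω, ∫⁻ y, F (Preorder.frestrictLe k ω, y) ∂(κ k (Preorder.frestrictLe k ω))
        ∂(Kernel.traj κ 0 x₀) := by
  have hm : Measurable fun ω : Π n, X n => F (Preorder.frestrictLe k ω, ω (k + 1)) := by fun_prop
  have hG : Measurable fun x => ∫⁻ y, F (x, y) ∂(κ k x) := hF.lintegral_kernel_prod_right'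
  rw [← MeasureTheory.lintegral_map hG (by fun_prop : Measurable (Preorder.frestrictLe (π := X) k)),
    Kernel.traj_map_frestrictLe_apply, ← Kernel.traj_comp_partialTraj (Nat.zero_le k),
    Kernel.lintegral_comp _ _ _ hm]
  refine lintegral_congr fun x => ?_
  have h1 : Measurable fun y => F (x, y) := by fun_prop
  rw [Kernel.lintegral_traj x hm, ← Kernel.map_traj_succ_self (κ := κ),
    Kernel.lintegral_map _ (measurable_pi_apply _) _ h1]
  refine lintegral_congr fun ω => ?_
  -- The trajectory restarted at time `k` has its coordinates up to `k` overwritten by `x`.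
  congr 2
  · funext i
    simp [Function.updateFinset, Preorder.frestrictLe]
  · simp [Function.updateFinset]

namespace RecProgram

variable {W : RecProgram} {Υ : W.SamplingFunction}

instance : Countable W.StackElem :=
  Function.Injective.countable (f := fun c : W.StackElem =>
    (⟨c.fn, c.label, c.val⟩ : Σ f, W.L f × Val (W.PV f))) fun c d h => by
      cases c
      cases d
      simp only [Sigma.mk.injEq] at h
      obtain ⟨rfl, h⟩ := h
      simpa using h

instance : Countable (W.History Υ) := inferInstanceAs (Countable (Subtype _))

instance : DiscreteMeasurableSpace (W.History Υ) := ⟨fun _ => trivial⟩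

/-- The indicator of the runs that have not terminated before time `k`. -/
noncomputable def alive (k : ℕ) (ω : ℕ → W.History Υ) : ℝ≥0∞ :=
  open Classical in ∏ j ∈ Finset.range k, if (ω j).last.1 = [] then 0 else 1

theorem measurable_comp_eval (φ : W.History Υ → ℝ≥0∞) (j : ℕ) :
    Measurable fun ω : ℕ → W.History Υ => φ (ω j) :=
  (Measurable.of_discrete (f := φ)).comp (measurable_pi_apply j)

theorem measurable_alive (k : ℕ) : Measurable (alive (W := W) (Υ := Υ) k) := by
  classical
  exact Finset.measurable_prod _ fun j _ =>
    measurable_comp_eval (fun ρ => if ρ.last.1 = [] then 0 else 1) j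

theorem alive_succ (k : ℕ) (ω : ℕ → W.History Υ) :
    alive (k + 1) ω = open Classical in alive k ω * if (ω k).last.1 = [] then 0 else 1 :=
  Finset.prod_range_succ _ _

theorem alive_of_forall_ne {k : ℕ} {ω : ℕ → W.History Υ} (h : ∀ j < k, (ω j).last.1 ≠ []) :
    alive k ω = 1 :=
  Finset.prod_eq_one fun j hj => if_neg (h j (Finset.mem_range.1 hj))

theorem alive_of_eq_nil {j k : ℕ} (hjk : j < k) {ω : ℕ → W.History Υ}
    (h : (ω j).last.1 = []) : alive k ω = 0 :=
  Finset.prod_eq_zero (Finset.mem_range.2 hjk) (if_pos h)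

/-- The pointwise tail-sum formula: `alive (k + 1)` is the indicator of termination after time `k`.
As it tests all times up to `k`, no absorption at the empty configuration is needed. -/
theorem termTime_eq_tsum_alive (ω : ℕ → W.History Υ) :
    termTime ω = ∑' k, alive (k + 1) ω := by
  classical
  by_cases h : ∃ n, (ω n).last.1 = []
  · have hlt : ∀ k < Nat.find h, alive (k + 1) ω = 1 := fun k hk =>
      alive_of_forall_ne fun j hj => Nat.find_min h (by lia)
    have hge : ∀ k, Nat.find h ≤ k → alive (k + 1) ω = 0 := fun k hk =>
      alive_of_eq_nil (by lia) (Nat.find_spec h)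
    rw [tsum_eq_sum (s := Finset.range (Nat.find h)) fun k hk => hge k (by simpa using hk),
      Finset.sum_congr rfl fun k hk => hlt k (Finset.mem_range.1 hk)]
    simp only [Finset.sum_const, Finset.card_range, nsmul_eq_mul, mul_one]
    exact le_antisymm (iInf₂_le (f := fun n (_ : (ω n).last.1 = []) => (n : ℝ≥0∞)) _
      (Nat.find_spec h))
      (le_iInf₂ fun n hn => by exact_mod_cast Nat.find_min' h hn)
  · push Not at h
    rw [tsum_congr fun k => alive_of_forall_ne fun j _ => h j, ENNReal.tsum_const_eq_top_of_ne_zero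
      one_ne_zero]
    simp [termTime, h]

theorem lintegral_termTime (σ : W.Scheduler Υ) (c : W.StackElem) (hc : ¬ c.Terminal) :
    ∫⁻ ω, termTime ω ∂(runMeasure σ c hc) =
      ⨆ n, ∑ j ∈ Finset.range n, ∫⁻ ω, alive (j + 1) ω ∂(runMeasure σ c hc) := by
  simp_rw [termTime_eq_tsum_alive]
  rw [lintegral_tsum fun k => (measurable_alive _).aemeasurable, ENNReal.tsum_eq_iSup_nat]

/-- Successor histories are reindexed by their last state. The sum may run over all actions because
the scheduler gives disabled ones mass zero. -/
theorem tsum_chainProb_mul (σ : W.Scheduler Υ) (ρ : W.History Υ) (φ : W.Config → ℝ≥0∞) :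
    ∑' ρ', chainProb σ ρ ρ' * φ ρ'.last.1 =
      ∑' a, σ.dist ρ a * W.stepMean Υ φ ρ.last.1 a := by
  classical
  let g : W.State → ℝ≥0∞ := fun s =>
    ∑' a : W.enabled Υ ρ.last, σ.dist ρ a * W.transProb Υ ρ.last a s
  have hg : ∀ s, g s ≠ 0 → ∃ a, 0 < W.transProb Υ ρ.last a s := by
    intro s hs
    by_contra! hcon
    exact hs (ENNReal.tsum_eq_zero.2 fun a => by simp [nonpos_iff_eq_zero.1 (hcon a)])
  have hval : ∀ s, g s ≠ 0 → ρ.1 ++ [s] ≠ [] ∧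
      (ρ.1 ++ [s]).IsChain fun s s' => ∃ a, 0 < W.transProb Υ s a s' := by
    intro s hs
    refine ⟨by simp, List.isChain_append.2 ⟨ρ.2.2, List.isChain_singleton _, ?_⟩⟩
    intro x hx y hy
    have hx' : ρ.last = x := by
      rw [List.getLast?_eq_getLast_of_ne_nil ρ.2.1] at hx
      simpa [History.last] using hx
    have hy' : s = y := by simpa using hy
    subst hx' hy'
    exact hg _ hs
  have hsum : ∑' ρ', chainProb σ ρ ρ' * φ ρ'.last.1 = ∑' s, g s * φ s.1 := by
    refine tsum_eq_tsum_of_ne_zero_bij (fun s : Function.support fun s => g s * φ s.1 =>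
      (⟨ρ.1 ++ [s.1], hval s.1 (left_ne_zero_of_mul s.2)⟩ : W.History Υ)) ?_ ?_ ?_
    · intro s t hst
      have := congrArg Subtype.val hst
      exact Subtype.ext (by simpa using this)
    · intro ρ' hρ'
      have h1 : ρ'.1 = ρ.1 ++ [ρ'.last] := by
        by_contra hne
        exact hρ' (by simp [chainProb, hne])
      refine ⟨⟨ρ'.last, ?_⟩, Subtype.ext h1.symm⟩
      have h2 := hρ'
      rw [Function.mem_support, chainProb, if_pos h1] at h2
      exact h2
    · intro s
      have hl : History.last (⟨ρ.1 ++ [s.1], hval s.1 (left_ne_zero_of_mul s.2)⟩ :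
          W.History Υ) = s.1 := by
        simp [History.last]
      simp [chainProb, hl, g]
  rw [hsum]
  simp only [g, ← ENNReal.tsum_mul_right]
  rw [ENNReal.tsum_comm]
  simp only [mul_assoc, ENNReal.tsum_mul_left, tsum_transProb_mul]
  refine tsum_subtype_eq_of_support_subset
    (f := fun a => σ.dist ρ a * W.stepMean Υ φ ρ.last.1 a) fun a ha => ?_
  exact σ.enabled_of_pos ρ a (pos_iff_ne_zero.2 (left_ne_zero_of_mul ha))

theorem lintegral_chainStep (σ : W.Scheduler Υ) (ρ : W.History Υ) (ψ : W.History Υ → ℝ≥0∞) :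
    ∫⁻ ρ', ψ ρ' ∂(chainStep σ ρ).toMeasure = ∑' ρ', chainProb σ ρ ρ' * ψ ρ' := by
  rw [lintegral_countable']
  refine tsum_congr fun ρ' => ?_
  rw [PMF.toMeasure_apply_singleton _ _ (measurableSet_singleton _), mul_comm]
  rfl

theorem lintegral_alive_mul_succ (σ : W.Scheduler Υ) (c : W.StackElem) (hc : ¬ c.Terminal)
    (k : ℕ) (ψ : W.History Υ → ℝ≥0∞) :
    ∫⁻ ω, alive (k + 1) ω * ψ (ω (k + 1)) ∂(runMeasure σ c hc) =
      ∫⁻ ω, alive (k + 1) ω * ∑' ρ', chainProb σ (ω k) ρ' * ψ ρ' ∂(runMeasure σ c hc) := by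
  classical
  let A : (Finset.Iic k → W.History Υ) → ℝ≥0∞ := fun x =>
    ∏ j : Finset.Iic k, if (x j).last.1 = [] then 0 else 1
  have hA : ∀ ω : ℕ → W.History Υ, alive (k + 1) ω = A (Preorder.frestrictLe k ω) := by
    intro ω
    rw [alive, Nat.range_succ_eq_Iic]
    exact (Finset.prod_coe_sort (Finset.Iic k)
      fun j => if (ω j).last.1 = [] then (0 : ℝ≥0∞) else 1).symm
  have hAm : Measurable A := Finset.measurable_prod _ fun j _ =>
    (Measurable.of_discrete
      (f := fun ρ : W.History Υ => if ρ.last.1 = [] then (0 : ℝ≥0∞) else 1)).comp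
        (measurable_pi_apply j)
  have hψ : Measurable ψ := Measurable.of_discrete
  have key := Kernel.lintegral_traj_succ (X := fun _ => W.History Υ) (chainKernel σ)
    (fun _ => W.initHistory Υ c hc) k (F := fun p => A p.1 * ψ p.2)
    ((hAm.comp measurable_fst).mul (hψ.comp measurable_snd))
  simp only [hA]
  refine key.trans (lintegral_congr fun ω => ?_)
  refine (lintegral_const_mul (A (Preorder.frestrictLe k ω)) hψ).trans ?_
  rw [← lintegral_chainStep]
  rfl

theorem lintegral_alive_succ_add (σ : W.Scheduler Υ) (c : W.StackElem) (hc : ¬ c.Terminal)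
    (k : ℕ) (ψ : W.History Υ → ℝ≥0∞) :
    ∫⁻ ω, alive (k + 1) ω ∂(runMeasure σ c hc) +
      ∫⁻ ω, alive (k + 1) ω * ψ (ω (k + 1)) ∂(runMeasure σ c hc) =
    ∫⁻ ω, alive (k + 1) ω * (1 + ∑' ρ', chainProb σ (ω k) ρ' * ψ ρ') ∂(runMeasure σ c hc) := by
  rw [lintegral_alive_mul_succ, ← lintegral_add_left (measurable_alive _)]
  simp [mul_add]

/-! ### Value iteration against schedulers. -/

theorem horizonTime_succ_of_ne_nil (n : ℕ) {w : W.Config} (hw : w ≠ []) :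
    W.horizonTime Υ (n + 1) w = 1 + ⨆ a, W.stepMean Υ (W.horizonTime Υ n) w a := by
  cases w with
  | nil => exact absurd rfl hw
  | cons c w => rfl

/-- The scheduler averages over actions, and an average is at most the supremum taken by value
iteration. The start `k` varies because the induction on `n` peels off the earliest step. -/
theorem sum_lintegral_alive_le (σ : W.Scheduler Υ) (c : W.StackElem) (hc : ¬ c.Terminal)
    (n k : ℕ) :
    ∑ j ∈ Finset.range n, ∫⁻ ω, alive (k + j + 1) ω ∂(runMeasure σ c hc) ≤
      ∫⁻ ω, alive k ω * W.horizonTime Υ n (ω k).last.1 ∂(runMeasure σ c hc) := by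
  induction n generalizing k with
  | zero => simp
  | succ n ih =>
    rw [Finset.sum_range_succ', add_comm (Finset.sum _ _)]
    have h := ih (k + 1)
    simp only [show ∀ j, k + 1 + j + 1 = k + (j + 1) + 1 by lia] at h
    refine (add_le_add_right h _).trans ?_
    rw [add_zero, lintegral_alive_succ_add σ c hc k fun ρ => W.horizonTime Υ n ρ.last.1]
    refine lintegral_mono fun ω => ?_
    dsimp only
    rw [alive_succ, tsum_chainProb_mul]
    split_ifs with hw
    · simp
    · rw [mul_one, horizonTime_succ_of_ne_nil n hw]
      gcongr
      calc _ ≤ ∑' a, σ.dist (ω k) a *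
            ⨆ a, W.stepMean Υ (W.horizonTime Υ n) (ω k).last.1 a := by
            refine ENNReal.tsum_le_tsum fun a => ?_
            gcongr
            exact le_iSup (fun a => W.stepMean Υ (W.horizonTime Υ n) (ω k).last.1 a) a
        _ = _ := by rw [ENNReal.tsum_mul_right, PMF.tsum_coe, one_mul]

/-- A deterministic scheduler that is optimal for the number of steps before termination among the
first `N` steps. -/
noncomputable def optimalScheduler (W : RecProgram) (Υ : W.SamplingFunction) (N : ℕ) :
    W.Scheduler Υ where
  -- A history of length `m` has `m - 1` steps behind it, so `N - m` of the `N` steps remain after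
  -- the one chosen here.
  dist ρ := PMF.pure
    (exists_optimal_action (Υ := Υ) (W.horizonTime Υ (N - ρ.1.length)) ρ.last.1).choose
  enabled_of_pos ρ a ha := by
    rw [mem_enabled_iff]
    have h := (PMF.mem_support_pure_iff _ _).1 ((PMF.mem_support_iff _ _).2 ha.ne')
    rw [h]
    exact (exists_optimal_action (Υ := Υ) (W.horizonTime Υ (N - ρ.1.length)) ρ.last.1).choose_spec.1

/-- The guard on the length says that exactly `n` steps remain, so the scheduler uses the right
horizon. Putting it in the integrand avoids proving that the history at time `k` almost surely has
length `k + 1`. -/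
theorem le_sum_lintegral_alive (N : ℕ) (c : W.StackElem) (hc : ¬ c.Terminal) (n k : ℕ) :
    ∫⁻ ω, alive k ω * (if (ω k).1.length + n = N + 1 then W.horizonTime Υ n (ω k).last.1 else 0)
        ∂(runMeasure (W.optimalScheduler Υ N) c hc) ≤
      ∑ j ∈ Finset.range n,
        ∫⁻ ω, alive (k + j + 1) ω ∂(runMeasure (W.optimalScheduler Υ N) c hc) := by
  induction n generalizing k with
  | zero => simp [horizonTime]
  | succ n ih =>
    rw [Finset.sum_range_succ', add_comm (Finset.sum _ _)]
    have h := ih (k + 1)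
    simp only [show ∀ j, k + 1 + j + 1 = k + (j + 1) + 1 by lia] at h
    refine le_trans ?_ (add_le_add_right h _)
    rw [add_zero, lintegral_alive_succ_add _ c hc k fun ρ =>
      if ρ.1.length + n = N + 1 then W.horizonTime Υ n ρ.last.1 else 0]
    refine lintegral_mono fun ω => ?_
    dsimp only
    rw [alive_succ]
    split_ifs with hlen hw
    · simp [hw]
    · rw [mul_one, horizonTime_succ_of_ne_nil n hw]
      gcongr
      set ρ := ω k
      -- The guard persists along transitions: the length grows by one as the number of remaining
      -- steps drops by one.
      have hcongr : ∀ ρ', chainProb (W.optimalScheduler Υ N) ρ ρ' *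
          (if ρ'.1.length + n = N + 1 then W.horizonTime Υ n ρ'.last.1 else 0) =
          chainProb (W.optimalScheduler Υ N) ρ ρ' * W.horizonTime Υ n ρ'.last.1 := by
        intro ρ'
        by_cases h1 : ρ'.1 = ρ.1 ++ [ρ'.last]
        · rw [if_pos]
          rw [h1, List.length_append, List.length_singleton]
          lia
        · simp [chainProb, h1]
      rw [tsum_congr hcongr, tsum_chainProb_mul]
      have hN : N - ρ.1.length = n := by lia
      have hopt := (exists_optimal_action (Υ := Υ)
        (W.horizonTime Υ (N - ρ.1.length)) ρ.last.1).choose_spec.2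
      refine le_trans ?_ (ENNReal.le_tsum (exists_optimal_action (Υ := Υ)
        (W.horizonTime Υ (N - ρ.1.length)) ρ.last.1).choose)
      simp only [optimalScheduler, PMF.pure_apply, if_true, one_mul]
      simp only [hN] at hopt ⊢
      exact hopt
    · simp
    · simp

theorem lintegral_runMeasure_zero (σ : W.Scheduler Υ) (c : W.StackElem) (hc : ¬ c.Terminal)
    (ψ : W.History Υ → ℝ≥0∞) :
    ∫⁻ ω, ψ (ω 0) ∂(runMeasure σ c hc) = ψ (W.initHistory Υ c hc) := by
  rw [runMeasure, Kernel.lintegral_traj _ (measurable_comp_eval ψ 0)]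
  simp [Function.updateFinset]

/-- Both bounds are used at `k = 0`, where `alive` is an empty product and the history is
deterministic of length one. -/
theorem supTime_eq_optimalTime (c : W.StackElem) :
    W.supTime Υ c = W.optimalTime Υ (W.push c []) := by
  unfold supTime push
  split
  · simp [optimalTime]
  · next hc =>
    have hlast : (W.initHistory Υ c hc).last.1 = [⟨c, hc⟩] := rfl
    refine le_antisymm (iSup_le fun σ => ?_) (iSup_le fun N => ?_)
    · rw [lintegral_termTime]
      refine iSup_le fun n => ?_
      have h := sum_lintegral_alive_le σ c hc n 0
      simp only [zero_add, alive, Finset.range_zero, Finset.prod_empty, one_mul] at h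
      rw [lintegral_runMeasure_zero σ c hc fun ρ => W.horizonTime Υ n ρ.last.1, hlast] at h
      exact h.trans (le_iSup (fun n => W.horizonTime Υ n [⟨c, hc⟩]) n)
    · refine le_trans ?_ (le_iSup _ (W.optimalScheduler Υ N))
      rw [lintegral_termTime]
      refine le_trans ?_ (le_iSup _ N)
      have h := le_sum_lintegral_alive (Υ := Υ) N c hc N 0
      simp only [zero_add, alive, Finset.range_zero, Finset.prod_empty, one_mul] at h
      rw [lintegral_runMeasure_zero _ c hc fun ρ =>
        if ρ.1.length + N = N + 1 then W.horizonTime Υ N ρ.last.1 else 0, hlast, if_pos] at h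
      · exact h
      · simp [initHistory, add_comm]

end RecProgram

theorem mainTheorem2 (W : RecProgram) (Υ : W.SamplingFunction) :
    W.IsRankingWith Υ 1 (W.supTime Υ) ∧
    (∀ (ε : ℝ≥0) (h : W.StackElem → ℝ≥0∞), W.IsRankingWith Υ ε h →
      ∀ c : W.StackElem, W.supTime Υ c ≤ h c / ε) ∧
    ∀ c : W.StackElem, W.BoundedlyTerminating Υ c ↔
      ∃ h : W.StackElem → ℝ≥0∞, W.IsRankingMeasureFunction Υ h ∧ h c < ∞ := by
  have hrank : W.IsRankingWith Υ 1 (W.supTime Υ) := by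
    rw [funext RecProgram.supTime_eq_optimalTime]
    exact RecProgram.isRankingWith_optimalTime
  have hle : ∀ (ε : ℝ≥0) (h : W.StackElem → ℝ≥0∞), W.IsRankingWith Υ ε h →
      ∀ c : W.StackElem, W.supTime Υ c ≤ h c / ε := fun ε h hh c => by
    rw [RecProgram.supTime_eq_optimalTime]
    exact hh.optimalTime_push_le c
  refine ⟨hrank, hle, fun c => ⟨fun hc => ⟨_, ⟨1, hrank⟩, hc⟩, ?_⟩⟩
  rintro ⟨h, ⟨ε, hh⟩, hc⟩
  exact (hle ε h hh c).trans_lt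
    (ENNReal.div_lt_top hc.ne (by simpa using hh.1.ne'))
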